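/- Let $W$ be a discrete memoryless channel with finite input alphabet $\mathcal X$ (for instance $|\mathcal X|=2$), finite output alphabet $\mathcal Y$ and capacity $C=\max_{P_X} I(X;Y)>0$ (all logarithms are to base 2), and fix $K\ge 1$. A $K$-RMOID (ranked-multiple-object identification) code of length $n$ for $N$ receivers consists of an encoder $\tilde\varphi$ that maps a ranking $\boldsymbol K=(i_1,\dots,i_K)$ of $K$ distinct receivers $i_j\in\{1,\dots,N\}$ and a random number $v\in\mathcal V$ to a word in $\mathcal X^n$, and of decoders $\tilde\psi_i:\mathcal Y^n\to\{1,\dots,K,\mathrm F\}$, $1\le i\le N$. Here $\mathrm F$ (outside of the ranking) is treated as rank $K+1$. Its rate is $R^{(n)}=\frac1n\log\log N$. Let $V$ be uniform on $\mathcal V$ and let $\tilde\varphi(\boldsymbol K,V)$ be sent through $W$; $\tilde\lambda_1^{(n)}$ (resp. $\tilde\lambda_2^{(n)}$) is the maximum, over all rankings $\boldsymbol K$ and all receivers $i$, of the probability that the rank decoded by receiver $i$ is larger (resp. smaller) than its true rank. Coding Scheme 2 uses an $\varepsilon$-almost strongly universal class of hash functions $h_v:\{1,\dots,N\}\to\mathcal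 B$, $v\in\mathcal V$: $|\{v: h_v(a)=b\}|=|\mathcal V|/|\mathcal B|$ for all $a,b$, and $|\{v: h_v(a_1)=b_1,\ h_v(a_2)=b_2\}|\le\varepsilon|\mathcal V|/|\mathcal B|$ for all $a_1\ne a_2$ and all $b_1,b_2$. Its parameters are those of the Kurosawa–Yoshida class: $q=2^m$, $N=q^{kq^t}$, $|\mathcal B|=q$, $|\mathcal V|=q^{k+2}$, $\varepsilon=\frac kq+\frac{q^t-1}{q^k}$, with $m,k\ge1$ and $t=k-1$. It also uses a transmission code $f:\mathcal V\times\mathcal B^K\to\mathcal X^n$, $g:\mathcal Y^n\to\mathcal V\times\mathcal B^K$. The encoder is $$\tilde\varphi(\boldsymbol K,v)=f(v,h_v(i_1),\dots,h_v(i_K)),$$ and, with $(\hat v,\beta_1,\dots,\beta_K)=g(y^n)$, $\tilde\psi_i(y^n)$ is the smallest $j$ such that $h_{\hat v}(i)=\beta_j$, or $\mathrm F$ if there is no such $j$. Then the hash classes and the transmission codes can be chosen, for every block length $n$, so that the $K$-RMOID codes constructed by Coding Scheme 2 attain $$\lim_{n\to\infty}R^{(n)}=C,\qquad \lim_{n\to\infty}\tilde\lambda_1^{(n)}=0,\qquad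 \lim_{n\to\infty}\tilde\lambda_2^{(n)}=0 .$$ -/

import Mathlib

noncomputable section

/-- A discrete memoryless channel with finite input alphabet `X` and finite output alphabet `Y`:
`W x` is the output distribution for the input letter `x`, so `(W x).1 y = W(y | x)`. -/
abbrev DMC (X Y : Type*) [Fintype Y] : Type _ := X → stdSimplex ℝ Y

/-- The probability `W^n(y^n | x^n)` of the output word `y` when `x` is sent through `n` independent
uses of the channel. -/
def DMC.wordProb {X Y : Type*} [Fintype Y] (W : DMC X Y) {n : ℕ} (x : Fin n → X) (y : Fin n → Y) :
    ℝ :=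
  ∏ s, (W (x s)).1 (y s)

/-- The mutual information `I(X; Y)` in bits, for input distribution `P` and channel `W`.
Terms of probability zero contribute zero. -/
def DMC.mutualInfo {X Y : Type*} [Fintype X] [Fintype Y] (W : DMC X Y) (P : stdSimplex ℝ X) : ℝ :=
  ∑ x, ∑ y, P.1 x * (W x).1 y * Real.logb 2 ((W x).1 y / ∑ x', P.1 x' * (W x').1 y)

/-- The channel capacity `C = max_P I(X; Y)`, in bits. -/
def DMC.capacity {X Y : Type*} [Fintype X] [Fintype Y] (W : DMC X Y) : ℝ :=
  ⨆ P : stdSimplex ℝ X, W.mutualInfo P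

open Classical in
/-- The position of the first entry of `β` that equals `b`; if there is none, the extra value
`Fin.last K`. Ranks `1, …, K` are represented by `0, …, K - 1`, and `F` (outside of the ranking,
treated as rank `K + 1`) by `Fin.last K`. -/
def firstRank {B : Type*} {K : ℕ} (b : B) (β : Fin K → B) : Fin (K + 1) :=
  if h : ∃ j, β j = b then (Fin.find (fun j => β j = b) h).castSucc else Fin.last K

/-- A `K`-RMOID (ranked-multiple-object identification) code of length `n` for `N` receivers whose
encoder uses a random number from a set of `M` elements. The ranked receivers `(i₁, …, i_K)` are
given as an injective tuple. -/
structure RMOIDCode (X Y : Type*) (K n N M : ℕ) where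
  /-- The encoder. -/
  enc : (Fin K ↪ Fin N) → Fin M → (Fin n → X)
  /-- The decoders of the `N` receivers, with outputs in `{1, …, K, F}`. -/
  dec : Fin N → (Fin n → Y) → Fin (K + 1)

namespace RMOIDCode

variable {X Y : Type*} [Fintype Y] {K n N M : ℕ}

open Classical in
/-- The probability that the rank decoded by receiver `i` satisfies `p`, when the ranking `κ` is
encoded with a uniformly distributed random number and the codeword is sent through `W`. -/
def decProb (c : RMOIDCode X Y K n N M) (W : DMC X Y) (κ : Fin K ↪ Fin N) (i : Fin N)
    (p : Fin (K + 1) → Prop) : ℝ :=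
  ∑ v : Fin M, (1 / (M : ℝ)) *
    ∑ y : Fin n → Y, if p (c.dec i y) then W.wordProb (c.enc κ v) y else 0

/-- The worst probability of a type I error: the decoded rank of a receiver is larger than its true
rank. -/
def typeI (c : RMOIDCode X Y K n N M) (W : DMC X Y) : ℝ :=
  ⨆ κ : Fin K ↪ Fin N, ⨆ i : Fin N, c.decProb W κ i (fun j => firstRank i κ < j)

/-- The worst probability of a type II error: the decoded rank of a receiver is smaller than its
true rank. -/
def typeII (c : RMOIDCode X Y K n N M) (W : DMC X Y) : ℝ :=
  ⨆ κ : Fin K ↪ Fin N, ⨆ i : Fin N, c.decProb W κ i (fun j => j < firstRank i κ)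

/-- The coding rate `(1 / n) log log N`, with logarithms to base 2. -/
def rate (_c : RMOIDCode X Y K n N M) : ℝ :=
  (1 / (n : ℝ)) * Real.logb 2 (Real.logb 2 (N : ℝ))

end RMOIDCode

open Classical in
/-- `h` is an `ε`-almost strongly universal class of hash functions `h v : A → B`, indexed by
`v : V`. -/
def IsAlmostStronglyUniversal {V A B : Type*} [Fintype V] [Fintype B] (h : V → A → B) (ε : ℝ) :
    Prop :=
  (∀ (a : A) (b : B),
    (Fintype.card {v : V // h v a = b} : ℝ) = (Fintype.card V : ℝ) / (Fintype.card B : ℝ)) ∧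
  ∀ (a₁ a₂ : A), a₁ ≠ a₂ → ∀ (b₁ b₂ : B),
    (Fintype.card {v : V // h v a₁ = b₁ ∧ h v a₂ = b₂} : ℝ)
      ≤ ε * ((Fintype.card V : ℝ) / (Fintype.card B : ℝ))

/-- The data from which the hash-based coding scheme for `K` ranked receivers builds a code of
length `n`: a class of hash functions with the parameters of the Kurosawa–Yoshida class,
and a transmission code for the channel. -/
structure RankedScheme (X Y : Type*) (K n : ℕ) where
  /-- The parameter `m` in `q = 2 ^ m`. -/
  m : ℕ
  hm : 1 ≤ m
  /-- The parameter `k` of the hash class. -/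
  k : ℕ
  /-- The parameter `t` of the hash class, chosen as `k - 1`. -/
  t : ℕ
  ht : t + 1 = k
  /-- The hash functions `h_v : {1, …, N} → B`, with `N = q ^ (k q ^ t)`, `|B| = q` and
  `|V| = q ^ (k + 2)`. -/
  hash : Fin ((2 ^ m) ^ (k + 2)) → Fin ((2 ^ m) ^ (k * (2 ^ m) ^ t)) → Fin (2 ^ m)
  hash_universal : IsAlmostStronglyUniversal hash
    ((k : ℝ) / 2 ^ m + ((2 ^ m : ℝ) ^ t - 1) / (2 ^ m : ℝ) ^ k)
  /-- The encoder of the transmission code. -/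
  f : Fin ((2 ^ m) ^ (k + 2)) × (Fin K → Fin (2 ^ m)) → (Fin n → X)
  /-- The decoder of the transmission code. -/
  g : (Fin n → Y) → Fin ((2 ^ m) ^ (k + 2)) × (Fin K → Fin (2 ^ m))

namespace RankedScheme

variable {X Y : Type*} {K n : ℕ}

/-- The `K`-RMOID code built by the scheme. The encoder sends
`f (v, h_v(i₁), …, h_v(i_K))`; receiver `i` computes `(v̂, β₁, …, β_K) = g(y)` and outputs the first
`j` with `h_v̂(i) = β_j`, or `F` if there is none. -/
def code (S : RankedScheme X Y K n) :
    RMOIDCode X Y K n ((2 ^ S.m) ^ (S.k * (2 ^ S.m) ^ S.t)) ((2 ^ S.m) ^ (S.k + 2)) where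
  enc κ v := S.f (v, fun j => S.hash v (κ j))
  dec i y := firstRank (S.hash (S.g y).1 i) (S.g y).2

end RankedScheme

end

/-!
The hash class is a concatenation: a polynomial with `q ^ t` coefficients in `GF(q ^ k)` is
evaluated at a random point, where two distinct polynomials agree with probability at most
`(q ^ t - 1) / q ^ k`, and the value, read as a polynomial `c` over `GF(q)` with `k` coefficients,
is mapped to `z + x * c(x)` for random `x`, `z`, which adds the term `k / q`.

If the transmission code delivers `(v, h_v(i₁), …, h_v(i_K))` intact, the decoded rank is never
larger than the true one, and it is smaller only if the receiver collides under `h_v` with a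
different ranked receiver. So the type I error is at most the error of the transmission code, and
the type II error exceeds it by at most `K ε`.

Transmission codes of any rate `γ < C` come from Feinstein's greedy argument: a new codeword is
chosen by averaging over the input distribution, and its decoding set consists of the typical
outputs not used up before. Typicality is the law of large numbers for the information density,
obtained from a Chernoff bound.

With `m = ⌊√n⌋` and `t` the largest integer for which the `q ^ (t + 3 + K)` messages fit into
`2 ^ (n γ)`, one has `log log N = m t + log (m k) = n γ - O(√n)`, while `ε` is at most
`(k + 1) / 2 ^ m → 0`. Letting `γ` tend to `C` slowly with `n` gives the theorem.
-/

open Filter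
open scoped Finset Polynomial Topology

section HashClasses

theorem card_filter_univ_prod {U V : Type*} [Fintype U] [Fintype V] (p : U × V → Prop)
    [DecidablePred p] : #{w | p w} = ∑ u, #{v | p (u, v)} := by
  simp only [Finset.card_filter, Fintype.sum_prod_type]

/-- An `ε`-almost universal class of hash functions `h v : A → B`, indexed by `v : V`: two distinct
arguments collide under at most a fraction `ε` of the class. It is the outer stage from which
almost strongly universal classes are built by composition. -/
def IsAlmostUniversal {V A B : Type*} [Fintype V] [DecidableEq B] (h : V → A → B) (ε : ℝ) : Prop :=
  ∀ a₁ a₂, a₁ ≠ a₂ → (#{v | h v a₁ = h v a₂} : ℝ) ≤ ε * Fintype.card V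

variable {U V A B C : Type*} [Fintype U] [Fintype V]

theorem IsAlmostUniversal.comp_injective [DecidableEq B] [DecidableEq C] {h : V → A → B} {ε : ℝ}
    (H : IsAlmostUniversal h ε) {e : B → C} (he : Function.Injective e) :
    IsAlmostUniversal (fun v a => e (h v a)) ε := fun a₁ a₂ ha => by
  simpa only [he.eq_iff] using H a₁ a₂ ha

theorem IsAlmostUniversal.card_exists_collision_le [DecidableEq B] {ι : Type*} [Fintype ι]
    {h : V → A → B} {ε : ℝ} (H : IsAlmostUniversal h ε) (hε : 0 ≤ ε) (κ : ι → A) (a : A)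
    [DecidablePred fun v => ∃ j, κ j ≠ a ∧ h v (κ j) = h v a] :
    (#{v | ∃ j, κ j ≠ a ∧ h v (κ j) = h v a} : ℝ) ≤ Fintype.card ι * ε * Fintype.card V := by
  classical
  have hj (j : ι) : (#{v | κ j ≠ a ∧ h v (κ j) = h v a} : ℝ) ≤ ε * Fintype.card V := by
    by_cases hja : κ j = a
    · simp only [hja, ne_eq, not_true_eq_false, false_and, Finset.filter_false, Finset.card_empty,
        Nat.cast_zero]
      positivity
    · simpa only [ne_eq, hja, not_false_eq_true, true_and] using H _ _ hja
  have hcover : ({v | ∃ j, κ j ≠ a ∧ h v (κ j) = h v a} : Finset V) ⊆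
      Finset.univ.biUnion fun j => {v | κ j ≠ a ∧ h v (κ j) = h v a} := fun v => by simp
  calc (#{v | ∃ j, κ j ≠ a ∧ h v (κ j) = h v a} : ℝ)
      ≤ ∑ j, (#{v | κ j ≠ a ∧ h v (κ j) = h v a} : ℝ) := by
        exact_mod_cast (Finset.card_le_card hcover).trans Finset.card_biUnion_le
    _ ≤ ∑ _j : ι, ε * Fintype.card V := Finset.sum_le_sum fun j _ => hj j
    _ = Fintype.card ι * ε * Fintype.card V := by
        rw [Finset.sum_const, Finset.card_univ, nsmul_eq_mul, mul_assoc]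

variable [Fintype B]

theorem isAlmostStronglyUniversal_iff [DecidableEq B] {h : V → A → B} {ε : ℝ} :
    IsAlmostStronglyUniversal h ε ↔
      (∀ a b, (#{v | h v a = b} : ℝ) = Fintype.card V / Fintype.card B) ∧
      ∀ a₁ a₂, a₁ ≠ a₂ → ∀ b₁ b₂,
        (#{v | h v a₁ = b₁ ∧ h v a₂ = b₂} : ℝ) ≤ ε * (Fintype.card V / Fintype.card B) := by
  simp only [IsAlmostStronglyUniversal, Fintype.card_subtype]

namespace IsAlmostStronglyUniversal

theorem isAlmostUniversal [Nonempty B] [DecidableEq B] {h : V → A → B} {ε : ℝ}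
    (H : IsAlmostStronglyUniversal h ε) : IsAlmostUniversal h ε := fun a₁ a₂ ha => by
  have hfiber : #{v | h v a₁ = h v a₂} = ∑ b, #{v | h v a₁ = b ∧ h v a₂ = b} := by
    rw [Finset.card_eq_sum_card_fiberwise (f := fun v => h v a₂) (t := Finset.univ) (by simp)]
    refine Finset.sum_congr rfl fun b _ => congrArg _ ?_
    grind
  calc (#{v | h v a₁ = h v a₂} : ℝ) = ∑ b, (#{v | h v a₁ = b ∧ h v a₂ = b} : ℝ) := by
        exact_mod_cast hfiber
    _ ≤ ∑ _b : B, ε * (Fintype.card V / Fintype.card B) :=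
        Finset.sum_le_sum fun b _ => (isAlmostStronglyUniversal_iff.1 H).2 a₁ a₂ ha b b
    _ = ε * Fintype.card V := by
        rw [Finset.sum_const, Finset.card_univ, nsmul_eq_mul]
        field_simp

theorem congr {V' A' B' : Type*} [Fintype V'] [Fintype B'] {h : V → A → B} {ε : ℝ}
    (H : IsAlmostStronglyUniversal h ε) (eV : V' ≃ V) (eA : A' ≃ A) (eB : B ≃ B') :
    IsAlmostStronglyUniversal (fun v a => eB (h (eV v) (eA a))) ε := by
  classical
  rw [IsAlmostStronglyUniversal, Fintype.card_congr eV, ← Fintype.card_congr eB]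
  refine ⟨fun a b => ?_, fun a₁ a₂ ha b₁ b₂ => ?_⟩
  · rw [← H.1 (eA a) (eB.symm b)]
    congr 1
    exact Fintype.card_congr (eV.subtypeEquiv fun v => by rw [Equiv.eq_symm_apply])
  · refine le_trans (le_of_eq ?_) (H.2 _ _ (eA.injective.ne ha) (eB.symm b₁) (eB.symm b₂))
    congr 1
    exact Fintype.card_congr (eV.subtypeEquiv fun v => by simp only [Equiv.eq_symm_apply])

theorem comp_isAlmostUniversal [DecidableEq C] {h₁ : U → A → C} {h₂ : V → C → B} {ε₁ ε₂ : ℝ}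
    (H₂ : IsAlmostStronglyUniversal h₂ ε₂) (hε₂ : 0 ≤ ε₂) (H₁ : IsAlmostUniversal h₁ ε₁) :
    IsAlmostStronglyUniversal (fun (w : U × V) a => h₂ w.2 (h₁ w.1 a)) (ε₂ + ε₁) := by
  classical
  rw [isAlmostStronglyUniversal_iff] at H₂ ⊢
  set r : ℝ := Fintype.card V / Fintype.card B
  have hr0 : 0 ≤ r := by positivity
  have hcard : (Fintype.card (U × V) : ℝ) / Fintype.card B = Fintype.card U * r := by
    rw [Fintype.card_prod, Nat.cast_mul, mul_div_assoc]
  refine ⟨fun a b => ?_, fun a₁ a₂ ha b₁ b₂ => ?_⟩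
  · rw [hcard, card_filter_univ_prod, Nat.cast_sum, Finset.sum_congr rfl fun u _ => H₂.1 (h₁ u a) b,
      Finset.sum_const, Finset.card_univ, nsmul_eq_mul]
  · have hu (u : U) : (#{v | h₂ v (h₁ u a₁) = b₁ ∧ h₂ v (h₁ u a₂) = b₂} : ℝ) ≤
        ε₂ * r + if h₁ u a₁ = h₁ u a₂ then r else 0 := by
      split_ifs with hcoll
      · calc (#{v | h₂ v (h₁ u a₁) = b₁ ∧ h₂ v (h₁ u a₂) = b₂} : ℝ)
            ≤ #{v | h₂ v (h₁ u a₁) = b₁} := by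
              gcongr with v
              exact And.left
          _ = r := H₂.1 _ _
          _ ≤ ε₂ * r + r := le_add_of_nonneg_left (mul_nonneg hε₂ hr0)
      · simpa only [add_zero] using H₂.2 _ _ hcoll b₁ b₂
    calc (#{w : U × V | h₂ w.2 (h₁ w.1 a₁) = b₁ ∧ h₂ w.2 (h₁ w.1 a₂) = b₂} : ℝ)
        = ∑ u, (#{v | h₂ v (h₁ u a₁) = b₁ ∧ h₂ v (h₁ u a₂) = b₂} : ℝ) := by
          rw [card_filter_univ_prod, Nat.cast_sum]
      _ ≤ ∑ u, (ε₂ * r + if h₁ u a₁ = h₁ u a₂ then r else 0) := Finset.sum_le_sum fun u _ => hu u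
      _ = Fintype.card U * (ε₂ * r) + #{u | h₁ u a₁ = h₁ u a₂} * r := by
          rw [Finset.sum_add_distrib, Finset.sum_const, Finset.card_univ, nsmul_eq_mul,
            ← Finset.sum_filter, Finset.sum_const, nsmul_eq_mul]
      _ ≤ Fintype.card U * (ε₂ * r) + ε₁ * Fintype.card U * r := by
          gcongr
          exact H₁ a₁ a₂ ha
      _ = (ε₂ + ε₁) * (Fintype.card (U × V) / Fintype.card B) := by
          rw [hcard]
          ring

end IsAlmostStronglyUniversal

end HashClasses

section PolynomialHash

theorem card_filter_eval_eq_zero_le {R : Type*} [CommRing R] [IsDomain R] [Fintype R]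
    [DecidableEq R] {p : R[X]} (hp : p ≠ 0) : #{x | p.eval x = 0} ≤ p.natDegree :=
  Polynomial.card_le_degree_of_subset_roots fun x hx => by simpa [hp] using hx

theorem isAlmostUniversal_eval_ofFn {R : Type*} [CommRing R] [IsDomain R] [Fintype R]
    [DecidableEq R] {T : ℕ} (hT : 1 ≤ T) :
    IsAlmostUniversal (fun z (a : Fin T → R) => (Polynomial.ofFn T a).eval z)
      (((T : ℝ) - 1) / Fintype.card R) := fun a₁ a₂ ha => by
  have hne : Polynomial.ofFn T a₁ - Polynomial.ofFn T a₂ ≠ 0 :=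
    sub_ne_zero.2 ((Polynomial.injective_ofFn T).ne ha)
  have hdeg : (Polynomial.ofFn T a₁ - Polynomial.ofFn T a₂).natDegree ≤ T - 1 := by
    rw [← map_sub]
    exact Nat.le_sub_one_of_lt (Polynomial.ofFn_natDegree_lt hT _)
  have hroots := (card_filter_eval_eq_zero_le hne).trans hdeg
  simp only [Polynomial.eval_sub, sub_eq_zero] at hroots
  calc _ ≤ ((T - 1 : ℕ) : ℝ) := by exact_mod_cast hroots
    _ = ((T : ℝ) - 1) / Fintype.card R * Fintype.card R := by
        rw [Nat.cast_sub hT, Nat.cast_one]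
        field_simp

theorem card_filter_mul_eval_ofFn_eq_le {R : Type*} [CommRing R] [IsDomain R] [Fintype R]
    [DecidableEq R] {k : ℕ} {c : Fin k → R} (hc : c ≠ 0) (d : R) :
    #{x | x * (Polynomial.ofFn k c).eval x = d} ≤ k := by
  have hp : Polynomial.ofFn k c ≠ 0 := by
    simpa only [map_zero] using (Polynomial.injective_ofFn k).ne hc
  have hdeg : (Polynomial.X * Polynomial.ofFn k c - Polynomial.C d).natDegree =
      (Polynomial.ofFn k c).natDegree + 1 := by
    rw [Polynomial.natDegree_sub_C, Polynomial.natDegree_X_mul hp]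
  have hne : Polynomial.X * Polynomial.ofFn k c - Polynomial.C d ≠ 0 :=
    Polynomial.ne_zero_of_natDegree_gt (n := 0) (by lia)
  have hroots := card_filter_eval_eq_zero_le hne
  simp only [Polynomial.eval_sub, Polynomial.eval_mul, Polynomial.eval_X, Polynomial.eval_C,
    sub_eq_zero] at hroots
  have hlt : (Polynomial.ofFn k c).natDegree < k :=
    Polynomial.ofFn_natDegree_lt
      (Nat.one_le_iff_ne_zero.2 (Polynomial.ne_zero_of_ofFn_ne_zero hp)) c
  lia

theorem isAlmostStronglyUniversal_add_mul_eval_ofFn (R : Type*) [CommRing R] [IsDomain R]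
    [Fintype R] [DecidableEq R] (k : ℕ) :
    IsAlmostStronglyUniversal
      (fun (v : R × R) (c : Fin k → R) => v.2 + v.1 * (Polynomial.ofFn k c).eval v.1)
      ((k : ℝ) / Fintype.card R) := by
  have hcard : (Fintype.card (R × R) : ℝ) / Fintype.card R = Fintype.card R := by
    rw [Fintype.card_prod, Nat.cast_mul]
    field_simp
  rw [isAlmostStronglyUniversal_iff, hcard]
  refine ⟨fun c b => ?_, fun c₁ c₂ hc b₁ b₂ => ?_⟩
  · rw [card_filter_univ_prod]
    simp [← eq_sub_iff_add_eq, Finset.filter_eq']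
  · have hinj : #{v : R × R | v.2 + v.1 * (Polynomial.ofFn k c₁).eval v.1 = b₁ ∧
        v.2 + v.1 * (Polynomial.ofFn k c₂).eval v.1 = b₂} ≤
        #{x | x * (Polynomial.ofFn k (c₁ - c₂)).eval x = b₁ - b₂} := by
      refine Finset.card_le_card_of_injOn Prod.fst (fun v hv => ?_) fun v hv w hw hvw => ?_
      · obtain ⟨h₁, h₂⟩ := (Finset.mem_filter.1 hv).2
        refine Finset.mem_filter.2 ⟨Finset.mem_univ _, ?_⟩
        rw [map_sub, Polynomial.eval_sub, ← h₁, ← h₂]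
        ring
      · have h := (Finset.mem_filter.1 hv).2.1.trans (Finset.mem_filter.1 hw).2.1.symm
        rw [hvw] at h
        exact Prod.ext hvw (add_right_cancel h)
    rw [div_mul_cancel₀ _ (by simp)]
    exact_mod_cast hinj.trans (card_filter_mul_eval_ofFn_eq_le (sub_ne_zero.2 hc) _)

theorem exists_kurosawaYoshida_hash {m k : ℕ} (hm : 1 ≤ m) (hk : 1 ≤ k) (t : ℕ) :
    ∃ h : Fin ((2 ^ m) ^ (k + 2)) → Fin ((2 ^ m) ^ (k * (2 ^ m) ^ t)) → Fin (2 ^ m),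
      IsAlmostStronglyUniversal h
        ((k : ℝ) / 2 ^ m + ((2 ^ m : ℝ) ^ t - 1) / (2 ^ m : ℝ) ^ k) := by
  classical
  let F := GaloisField 2 m
  let L := GaloisField 2 (m * k)
  let _ : Fintype F := Fintype.ofFinite F
  let _ : Fintype L := Fintype.ofFinite L
  have hF : Fintype.card F = 2 ^ m := by
    rw [← Nat.card_eq_fintype_card]
    exact GaloisField.card 2 m (by lia)
  have hL : Fintype.card L = (2 ^ m) ^ k := by
    rw [← Nat.card_eq_fintype_card, ← pow_mul]
    exact GaloisField.card 2 (m * k) (by positivity)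
  let e : L ≃ (Fin k → F) := Fintype.equivOfCardEq (by simp [hL, hF])
  let eV : Fin ((2 ^ m) ^ (k + 2)) ≃ L × F × F := Fintype.equivOfCardEq (by
    rw [Fintype.card_prod, Fintype.card_prod, hF, hL, Fintype.card_fin]
    ring)
  let eA : Fin ((2 ^ m) ^ (k * (2 ^ m) ^ t)) ≃ (Fin ((2 ^ m) ^ t) → L) :=
    Fintype.equivOfCardEq (by simp [hL, pow_mul])
  let eB : F ≃ Fin (2 ^ m) := Fintype.equivOfCardEq (by simp [hF])
  have outer := isAlmostUniversal_eval_ofFn (R := L) (T := (2 ^ m) ^ t)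
    (Nat.one_le_pow _ _ (by positivity))
  have inner := isAlmostStronglyUniversal_add_mul_eval_ofFn F k
  have H := (inner.comp_isAlmostUniversal (by positivity)
    (outer.comp_injective e.injective)).congr eV eA eB
  rw [hF, hL] at H
  push_cast at H
  exact ⟨_, H⟩

end PolynomialHash

section EventProb

/-- The probability of the event `E` under the distribution `p` on a finite alphabet. Events are
sets, so that no decidability of the decoding conditions is needed. -/
noncomputable def eventProb {X : Type*} [Fintype X] (p : stdSimplex ℝ X) (E : Set X) : ℝ :=
  ∑ x, E.indicator p.1 x

/-- The law of a family of independent letters with distributions `p i`. -/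
noncomputable def productLaw {ι X : Type*} [Fintype ι] [DecidableEq ι] [Fintype X]
    (p : ι → stdSimplex ℝ X) : stdSimplex ℝ (ι → X) :=
  ⟨fun x => ∏ i, (p i).1 (x i), fun _ => Finset.prod_nonneg fun i _ => (p i).2.1 _, by
    rw [← Fintype.prod_sum]
    exact Finset.prod_eq_one fun i _ => (p i).2.2⟩

variable {X : Type*} [Fintype X]

theorem eventProb_nonneg (p : stdSimplex ℝ X) (E : Set X) : 0 ≤ eventProb p E :=
  Finset.sum_nonneg fun _ _ => Set.indicator_nonneg (fun _ _ => p.2.1 _) _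

theorem eventProb_mono (p : stdSimplex ℝ X) {E F : Set X} (h : E ⊆ F) :
    eventProb p E ≤ eventProb p F :=
  Finset.sum_le_sum fun _ _ => Set.indicator_le_indicator_of_subset h p.2.1 _

theorem eventProb_union_le (p : stdSimplex ℝ X) (E F : Set X) :
    eventProb p (E ∪ F) ≤ eventProb p E + eventProb p F := by
  rw [eventProb, eventProb, eventProb, ← Finset.sum_add_distrib]
  refine Finset.sum_le_sum fun x _ => ?_
  rw [← Set.indicator_union_add_inter_apply]
  exact le_add_of_nonneg_right (Set.indicator_nonneg (fun _ _ => p.2.1 _) _)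

theorem eventProb_le_one (p : stdSimplex ℝ X) (E : Set X) : eventProb p E ≤ 1 :=
  (eventProb_mono p E.subset_univ).trans_eq (by
    simpa only [eventProb, Set.indicator_univ] using p.2.2)

theorem nonempty_of_stdSimplex (p : stdSimplex ℝ X) : Nonempty X :=
  not_isEmpty_iff.1 fun _ => by simpa using p.2.2

theorem exists_le_of_sum_mul_le (p : stdSimplex ℝ X) {f : X → ℝ} {c : ℝ}
    (h : ∑ x, p.1 x * f x ≤ c) : ∃ x, f x ≤ c := by
  have := nonempty_of_stdSimplex p
  obtain ⟨x₀, hx₀⟩ := Finite.exists_min f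
  refine ⟨x₀, le_trans ?_ h⟩
  calc f x₀ = ∑ x, p.1 x * f x₀ := by rw [← Finset.sum_mul, p.2.2, one_mul]
    _ ≤ ∑ x, p.1 x * f x :=
        Finset.sum_le_sum fun x _ => mul_le_mul_of_nonneg_left (hx₀ x) (p.2.1 x)

end EventProb

section Chernoff

variable {Z : Type*} [Fintype Z] (p : stdSimplex ℝ Z) {f : Z → ℝ} {γ : ℝ}

-- At `θ = 0` the sum is `1` and its derivative is `γ - E f < 0`.
theorem exists_pos_sum_mul_exp_lt_one (hγ : γ < ∑ z, p.1 z * f z) :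
    ∃ θ : ℝ, 0 < θ ∧ ∑ z, p.1 z * Real.exp (θ * (γ - f z)) < 1 := by
  set φ : ℝ → ℝ := fun θ => ∑ z, p.1 z * Real.exp (θ * (γ - f z)) with hφ
  have hφ_zero : φ 0 = 1 := by simpa [hφ] using p.2.2
  have hderiv : HasDerivAt φ (∑ z, p.1 z * (γ - f z)) 0 := by
    refine HasDerivAt.fun_sum fun z _ => ?_
    simpa using (((hasDerivAt_id (0 : ℝ)).mul_const (γ - f z)).exp).const_mul (p.1 z)
  have hneg : ∑ z, p.1 z * (γ - f z) < 0 := by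
    simpa [mul_sub, ← Finset.sum_mul, p.2.2] using hγ
  have hslope : ∀ᶠ θ in 𝓝[>] 0, slope φ 0 θ < 0 :=
    ((hasDerivAt_iff_tendsto_slope.1 hderiv).mono_left
      (nhdsGT_le_nhdsNE 0)).eventually_lt_const hneg
  obtain ⟨θ, hslope, hθ : 0 < θ⟩ := (hslope.and self_mem_nhdsWithin).exists
  rw [slope_def_field, hφ_zero, sub_zero, div_lt_iff₀ hθ, zero_mul, sub_neg] at hslope
  exact ⟨θ, hθ, hslope⟩

theorem eventProb_productLaw_sum_lt_le {θ : ℝ} (hθ : 0 ≤ θ) (n : ℕ) :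
    eventProb (productLaw fun _ : Fin n => p) {z | ∑ s, f (z s) < n * γ} ≤
      (∑ z, p.1 z * Real.exp (θ * (γ - f z))) ^ n := by
  rw [Fintype.sum_pow]
  refine Finset.sum_le_sum fun z _ => Set.indicator_apply_le' (fun hz => ?_) fun _ =>
    Finset.prod_nonneg fun s _ => mul_nonneg (p.2.1 _) (Real.exp_pos _).le
  rw [Finset.prod_mul_distrib, ← Real.exp_sum, ← Finset.mul_sum, Finset.sum_sub_distrib]
  refine le_mul_of_one_le_right ((productLaw fun _ => p).2.1 z) (Real.one_le_exp ?_)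
  simpa using mul_nonneg hθ (sub_nonneg.2 (Set.mem_ofPred.1 hz).le)

theorem tendsto_eventProb_productLaw_sum_lt (hγ : γ < ∑ z, p.1 z * f z) :
    Tendsto (fun n : ℕ => eventProb (productLaw fun _ : Fin n => p) {z | ∑ s, f (z s) < n * γ})
      atTop (𝓝 0) := by
  obtain ⟨θ, hθ, hlt⟩ := exists_pos_sum_mul_exp_lt_one p hγ
  exact squeeze_zero (fun n => eventProb_nonneg _ _)
    (eventProb_productLaw_sum_lt_le p hθ.le)
    (tendsto_pow_atTop_nhds_zero_of_lt_one
      (Finset.sum_nonneg fun z _ => mul_nonneg (p.2.1 z) (Real.exp_pos _).le) hlt)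

end Chernoff

theorem exists_decoder_of_pairwise_disjoint {S Y : Type*} [Nonempty S] {D : S → Set Y}
    (hD : Pairwise (Function.onFun Disjoint D)) : ∃ g : Y → S, ∀ s, ∀ y ∈ D s, g y = s := by
  classical
  refine ⟨fun y => if h : ∃ s, y ∈ D s then h.choose else Classical.arbitrary S, fun s y hy => ?_⟩
  have h : ∃ s, y ∈ D s := ⟨s, hy⟩
  exact (dif_pos h).trans (hD.eq (Set.not_disjoint_iff.2 ⟨y, h.choose_spec, hy⟩))

namespace DMC

variable {X Y S : Type*} [Fintype Y]

/-- The channel obtained from `n` independent uses of `W`, acting on words of length `n`. -/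
noncomputable def word (W : DMC X Y) (n : ℕ) : DMC (Fin n → X) (Fin n → Y) :=
  fun x => productLaw fun s => W (x s)

/-- The code with encoder `f` and decoder `g` has maximal error probability at most `ε` over the
channel `W`. -/
def IsReliable (W : DMC X Y) (f : S → X) (g : Y → S) (ε : ℝ) : Prop :=
  ∀ s, eventProb (W (f s)) {y | g y ≠ s} ≤ ε

theorem IsReliable.nonneg [Nonempty S] {W : DMC X Y} {f : S → X} {g : Y → S} {ε : ℝ}
    (h : W.IsReliable f g ε) : 0 ≤ ε :=
  (eventProb_nonneg _ _).trans (h (Classical.arbitrary S))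

variable [Fintype X] (W : DMC X Y) (P : stdSimplex ℝ X)

/-- The joint law of the input and output letters of `W` for the input distribution `P`. -/
noncomputable def joint : stdSimplex ℝ (X × Y) :=
  ⟨fun z => P.1 z.1 * (W z.1).1 z.2, fun z => mul_nonneg (P.2.1 _) ((W z.1).2.1 _), by
    have hW (x : X) : ∑ y, (W x).1 y = 1 := (W x).2.2
    simpa only [Fintype.sum_prod_type, ← Finset.mul_sum, hW, mul_one] using P.2.2⟩

/-- The law of the output letter of `W` for the input distribution `P`. -/
noncomputable def output : stdSimplex ℝ Y :=
  ⟨fun y => ∑ x, P.1 x * (W x).1 y,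
    fun y => Finset.sum_nonneg fun x _ => mul_nonneg (P.2.1 x) ((W x).2.1 y), by
    rw [Finset.sum_comm, ← Fintype.sum_prod_type']
    exact (W.joint P).2.2⟩

/-- The information density `i(x; y)`, in bits; its mean under `W.joint P` is the mutual
information. -/
noncomputable def infoDensity (z : X × Y) : ℝ :=
  Real.logb 2 ((W z.1).1 z.2 / (W.output P).1 z.2)

theorem mutualInfo_eq_sum_joint :
    W.mutualInfo P = ∑ z, (W.joint P).1 z * W.infoDensity P z :=
  (Fintype.sum_prod_type' _).symm

theorem eventProb_output (E : Set Y) :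
    eventProb (W.output P) E = ∑ x, P.1 x * eventProb (W x) E := by
  classical
  simp only [eventProb, output, Set.indicator_apply, Finset.mul_sum, mul_ite, mul_zero]
  rw [Finset.sum_comm]
  exact Finset.sum_congr rfl fun y _ => by split_ifs <;> simp

theorem output_word (n : ℕ) :
    (W.word n).output (productLaw fun _ => P) = productLaw fun _ => W.output P := by
  ext y
  change ∑ x : Fin n → X, (∏ s, P.1 (x s)) * ∏ s, (W (x s)).1 (y s) =
    ∏ s, ∑ x, P.1 x * (W x).1 (y s)
  simp only [← Finset.prod_mul_distrib, Fintype.prod_sum]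

section Feinstein

variable (E : X → Set Y)

-- Average over `x ~ P` and pick a codeword that is at least as good.
theorem exists_eventProb_compl_diff_le (U : Set Y) :
    ∃ x, eventProb (W x) (E x \ U)ᶜ ≤
      ∑ x, P.1 x * eventProb (W x) (E x)ᶜ + eventProb (W.output P) U := by
  refine exists_le_of_sum_mul_le P ?_
  rw [eventProb_output, ← Finset.sum_add_distrib]
  refine Finset.sum_le_sum fun x _ => ?_
  rw [← mul_add, Set.sdiff_eq, Set.compl_inter, compl_compl]
  exact mul_le_mul_of_nonneg_left (eventProb_union_le _ _ _) (P.2.1 x)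

variable {E} {θ ε : ℝ}

theorem eventProb_output_le_one_div (hθ : 0 < θ)
    (hE : ∀ x, ∀ y ∈ E x, θ * (W.output P).1 y ≤ (W x).1 y) (x : X) :
    eventProb (W.output P) (E x) ≤ 1 / θ := by
  rw [le_div_iff₀' hθ, eventProb, Finset.mul_sum]
  refine (Finset.sum_le_sum fun y _ => ?_).trans (eventProb_le_one (W x) (E x))
  by_cases hy : y ∈ E x
  · simpa only [Set.indicator_of_mem hy] using hE x y hy
  · simp only [Set.indicator_of_notMem hy, mul_zero, le_refl]

theorem exists_greedy_decoding_sets (hθ : 0 < θ)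
    (hE : ∀ x, ∀ y ∈ E x, θ * (W.output P).1 y ≤ (W x).1 y) :
    ∃ (x : ℕ → X) (D : ℕ → Set Y), Pairwise (Function.onFun Disjoint D) ∧
      ∀ n, eventProb (W (x n)) (D n)ᶜ ≤ ∑ x, P.1 x * eventProb (W x) (E x)ᶜ + n / θ := by
  choose c hc using W.exists_eventProb_compl_diff_le P E
  -- `U n` is the part of the output alphabet used up by the first `n` codewords.
  let U : ℕ → Set Y := Nat.rec ∅ fun _ V => V ∪ E (c V)
  have hU_mono : Monotone U := monotone_nat_of_le_succ fun n => Set.subset_union_left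
  have hU_prob (n : ℕ) : eventProb (W.output P) (U n) ≤ n / θ := by
    induction n with
    | zero => simp [U, eventProb]
    | succ n ih =>
      calc eventProb (W.output P) (U n ∪ E (c (U n)))
          ≤ n / θ + 1 / θ := (eventProb_union_le _ _ _).trans
            (add_le_add ih (W.eventProb_output_le_one_div P hθ hE _))
        _ = (n + 1 : ℕ) / θ := by
            push_cast
            ring
  refine ⟨fun n => c (U n), fun n => E (c (U n)) \ U n, ?_, fun n => (hc (U n)).trans ?_⟩
  · refine (pairwise_disjoint_on _).2 fun i j hij => ?_
    have hsub : E (c (U i)) ⊆ U j := Set.subset_union_right.trans (hU_mono hij)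
    exact Set.disjoint_sdiff_right.mono_left (Set.sdiff_subset.trans hsub)
  · gcongr
    exact hU_prob n

theorem exists_isReliable [Fintype S] [Nonempty S] (hθ : 0 < θ)
    (hE : ∀ x, ∀ y ∈ E x, θ * (W.output P).1 y ≤ (W x).1 y)
    (hε : ∑ x, P.1 x * eventProb (W x) (E x)ᶜ + Fintype.card S / θ ≤ ε) :
    ∃ (f : S → X) (g : Y → S), W.IsReliable f g ε := by
  obtain ⟨x, D, hD, hx⟩ := W.exists_greedy_decoding_sets P hθ hE
  let index (s : S) : ℕ := Fintype.equivFin S s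
  have hindex : Function.Injective index := Fin.val_injective.comp (Fintype.equivFin S).injective
  obtain ⟨g, hg⟩ := exists_decoder_of_pairwise_disjoint (hD.comp_of_injective hindex)
  refine ⟨x ∘ index, g, fun s => ?_⟩
  calc eventProb (W (x (index s))) {y | g y ≠ s}
      ≤ eventProb (W (x (index s))) (D (index s))ᶜ := eventProb_mono _ fun y hy hD => hy (hg s y hD)
    _ ≤ ∑ x, P.1 x * eventProb (W x) (E x)ᶜ + index s / θ := hx _
    _ ≤ ∑ x, P.1 x * eventProb (W x) (E x)ᶜ + Fintype.card S / θ := by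
        gcongr
        exact (Fintype.equivFin S s).2.le
    _ ≤ ε := hε

end Feinstein

theorem output_pos_of_joint_pos {z : X × Y} (hz : 0 < (W.joint P).1 z) :
    0 < (W.output P).1 z.2 :=
  hz.trans_le (Finset.single_le_sum (f := fun x => P.1 x * (W x).1 z.2)
    (fun x _ => mul_nonneg (P.2.1 x) ((W x).2.1 _)) (Finset.mem_univ z.1))

theorem sum_infoDensity_lt_iff {n : ℕ} {z : Fin n → X × Y} (hz : ∀ s, 0 < (W.joint P).1 (z s))
    (a : ℝ) :
    ∑ s, W.infoDensity P (z s) < a ↔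
      (W.word n fun s => (z s).1).1 (fun s => (z s).2) <
        2 ^ a * (productLaw fun _ => W.output P).1 fun s => (z s).2 := by
  have hW (s : Fin n) : 0 < (W (z s).1).1 (z s).2 := pos_of_mul_pos_right (hz s) (P.2.1 _)
  have hQ (s : Fin n) : 0 < (W.output P).1 (z s).2 := W.output_pos_of_joint_pos P (hz s)
  have hprod : 0 < ∏ s, (W.output P).1 (z s).2 := Finset.prod_pos fun s _ => hQ s
  simp only [infoDensity]
  rw [← Real.logb_prod _ _ fun s _ => (div_pos (hW s) (hQ s)).ne', Finset.prod_div_distrib,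
    Real.logb_lt_iff_lt_rpow one_lt_two (div_pos (Finset.prod_pos fun s _ => hW s) hprod),
    div_lt_iff₀ hprod]
  rfl

theorem sum_mul_eventProb_word_compl_le (n : ℕ) (a : ℝ) :
    ∑ x, (productLaw fun _ : Fin n => P).1 x * eventProb (W.word n x)
      {y | 2 ^ a * (productLaw fun _ => W.output P).1 y ≤ (W.word n x).1 y}ᶜ ≤
    eventProb (productLaw fun _ : Fin n => W.joint P) {z | ∑ s, W.infoDensity P (z s) < a} := by
  classical
  simp only [eventProb, Finset.mul_sum]
  rw [← (Equiv.arrowProdEquivProdArrow (Fin n) (fun _ => X) fun _ => Y).symm.sum_comp,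
    Fintype.sum_prod_type]
  refine Finset.sum_le_sum fun x _ => Finset.sum_le_sum fun y _ => ?_
  have hjoint : (productLaw fun _ => W.joint P).1 (fun s => (x s, y s)) =
      (productLaw fun _ => P).1 x * (W.word n x).1 y := by
    simp only [productLaw, joint, word, Finset.prod_mul_distrib]
  have hnonneg := (productLaw fun _ : Fin n => W.joint P).2.1 fun s => (x s, y s)
  rw [← Set.indicator_const_mul]
  refine Set.indicator_apply_le' (fun hy => ?_) fun _ => Set.indicator_nonneg (fun _ _ =>
    (productLaw fun _ : Fin n => W.joint P).2.1 _) _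
  rw [← hjoint]
  rcases hnonneg.eq_or_lt with h0 | hpos
  · rw [← h0]
    exact Set.indicator_nonneg (fun _ _ => (productLaw fun _ : Fin n => W.joint P).2.1 _) _
  · have hpos_letter (s : Fin n) : 0 < (W.joint P).1 (x s, y s) :=
      ((W.joint P).2.1 _).lt_of_ne' fun h => hpos.ne' (Finset.prod_eq_zero (Finset.mem_univ s) h)
    refine (Set.indicator_of_mem ?_ _).ge
    exact (W.sum_infoDensity_lt_iff P hpos_letter a).2 (not_le.1 hy)

theorem eventually_exists_isReliable {γ ε : ℝ} (hγ : γ < W.mutualInfo P) (hε : 0 < ε) :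
    ∀ᶠ n : ℕ in atTop, ∀ (S : Type*) [Fintype S] [Nonempty S], (Fintype.card S : ℝ) ≤ 2 ^ (n * γ) →
      ∃ (f : S → Fin n → X) (g : (Fin n → Y) → S), (W.word n).IsReliable f g ε := by
  obtain ⟨γ', hγγ', hγ'⟩ := exists_between hγ
  rw [mutualInfo_eq_sum_joint] at hγ'
  have hdensity := tendsto_eventProb_productLaw_sum_lt (W.joint P) hγ'
  have hrate : Tendsto (fun n : ℕ => (2 ^ (γ - γ') : ℝ) ^ n) atTop (𝓝 0) :=
    tendsto_pow_atTop_nhds_zero_of_lt_one (by positivity)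
      (Real.rpow_lt_one_of_one_lt_of_neg one_lt_two (sub_neg.2 hγγ'))
  have hsmall := (hdensity.add hrate).eventually_lt_const (by simpa using hε)
  filter_upwards [hsmall] with n hn S _ _ hS
  refine (W.word n).exists_isReliable (productLaw fun _ => P) (θ := 2 ^ (n * γ'))
    (E := fun x => {y | 2 ^ (n * γ') * (productLaw fun _ => W.output P).1 y ≤ (W.word n x).1 y})
    (by positivity) (fun x y hy => by rwa [output_word]) ?_
  have hcard : (Fintype.card S : ℝ) / 2 ^ (n * γ') ≤ (2 ^ (γ - γ') : ℝ) ^ n := by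
    rw [← Real.rpow_natCast, ← Real.rpow_mul zero_le_two, mul_comm (γ - γ'), mul_sub,
      Real.rpow_sub zero_lt_two]
    gcongr
  exact (add_le_add (W.sum_mul_eventProb_word_compl_le P n _) hcard).trans hn.le

theorem exists_lt_mutualInfo {γ : ℝ} (hγ : 0 ≤ γ) (h : γ < W.capacity) :
    ∃ P, γ < W.mutualInfo P := by
  by_contra! hle
  exact h.not_ge (Real.iSup_le hle hγ)

end DMC

section FirstRank

theorem firstRank_lt_iff {B : Type*} {K : ℕ} {b : B} {β : Fin K → B} {r : Fin (K + 1)} :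
    firstRank b β < r ↔ ∃ j, β j = b ∧ j.castSucc < r := by
  classical
  unfold firstRank
  split_ifs with h
  · refine ⟨fun hr => ⟨_, Fin.find_spec h, hr⟩, fun ⟨j, hj, hjr⟩ => lt_of_le_of_lt ?_ hjr⟩
    exact Fin.castSucc_le_castSucc_iff.2 (Fin.find_le_of_pos h hj)
  · exact iff_of_false (Fin.le_last r).not_gt fun ⟨j, hj, _⟩ => h ⟨j, hj⟩

variable {A B : Type*} {K : ℕ} (h : A → B) (a : A) (κ : Fin K → A)

theorem firstRank_map_le : firstRank (h a) (fun j => h (κ j)) ≤ firstRank a κ := by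
  by_contra! hlt
  obtain ⟨j, hj, hjr⟩ := firstRank_lt_iff.1 hlt
  exact (firstRank_lt_iff.2 ⟨j, congrArg h hj, hjr⟩).false

variable {h a κ}

theorem exists_collision_of_firstRank_map_lt
    (hlt : firstRank (h a) (fun j => h (κ j)) < firstRank a κ) : ∃ j, κ j ≠ a ∧ h (κ j) = h a := by
  obtain ⟨j, hj, hjr⟩ := firstRank_lt_iff.1 hlt
  exact ⟨j, fun hja => (firstRank_lt_iff.2 ⟨j, hja, hjr⟩).false, hj⟩

end FirstRank

namespace RMOIDCode

variable {X Y : Type*} [Fintype Y] {K n N M : ℕ} (c : RMOIDCode X Y K n N M) (W : DMC X Y)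

theorem decProb_eq (κ : Fin K ↪ Fin N) (i : Fin N) (p : Fin (K + 1) → Prop) :
    c.decProb W κ i p = (∑ v, eventProb (W.word n (c.enc κ v)) {y | p (c.dec i y)}) / M := by
  classical
  rw [decProb, ← Finset.mul_sum, one_div_mul_eq_div]
  simp only [eventProb, Set.indicator_apply]
  rfl

theorem decProb_nonneg (κ : Fin K ↪ Fin N) (i : Fin N) (p : Fin (K + 1) → Prop) :
    0 ≤ c.decProb W κ i p := by
  rw [decProb_eq]
  exact div_nonneg (Finset.sum_nonneg fun _ _ => eventProb_nonneg _ _) M.cast_nonneg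

theorem typeI_nonneg : 0 ≤ c.typeI W :=
  Real.iSup_nonneg fun _ => Real.iSup_nonneg fun _ => c.decProb_nonneg _ _ _ _

theorem typeII_nonneg : 0 ≤ c.typeII W :=
  Real.iSup_nonneg fun _ => Real.iSup_nonneg fun _ => c.decProb_nonneg _ _ _ _

/-- The figures of merit of a code over the channel `W`: its rate and its two error probabilities.
Bundling them lets a sequence of codes be chosen by one scalar criterion, the distance to
`(C, 0, 0)`. -/
noncomputable def performance : ℝ × ℝ × ℝ :=
  (c.rate, c.typeI W, c.typeII W)

end RMOIDCode

namespace RankedScheme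

section Errors

variable {X Y : Type*} {K n : ℕ} (S : RankedScheme X Y K n)

/-- The collision parameter `ε` of the hash class of the scheme. -/
noncomputable def hashError : ℝ :=
  (S.k : ℝ) / 2 ^ S.m + ((2 ^ S.m : ℝ) ^ S.t - 1) / (2 ^ S.m : ℝ) ^ S.k

theorem hashError_nonneg : 0 ≤ S.hashError :=
  add_nonneg (by positivity)
    (div_nonneg (sub_nonneg.2 (one_le_pow₀ (one_le_pow₀ one_le_two))) (by positivity))

theorem hashError_le : S.hashError ≤ (S.t + 2) / 2 ^ S.m := by
  have hk : (S.k : ℝ) = S.t + 1 := by exact_mod_cast S.ht.symm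
  calc S.hashError
      ≤ (S.k : ℝ) / 2 ^ S.m + (2 ^ S.m : ℝ) ^ S.t / (2 ^ S.m : ℝ) ^ S.k := by
        unfold hashError
        gcongr
        exact sub_le_self _ zero_le_one
    _ = (S.t + 2) / 2 ^ S.m := by
        rw [hk, ← S.ht, pow_succ]
        field_simp
        ring

variable [Fintype Y] {W : DMC X Y} {S} {δ : ℝ}

theorem typeI_le (h : (W.word n).IsReliable S.f S.g δ) : S.code.typeI W ≤ δ := by
  have hδ := h.nonneg
  refine Real.iSup_le (fun κ => Real.iSup_le (fun i => ?_) hδ) hδ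
  rw [RMOIDCode.decProb_eq]
  have hv (v : Fin ((2 ^ S.m) ^ (S.k + 2))) :
      eventProb (W.word n (S.code.enc κ v)) {y | firstRank i κ < S.code.dec i y} ≤ δ := by
    refine (eventProb_mono _ fun y hy hg => ?_).trans (h (v, fun j => S.hash v (κ j)))
    refine (firstRank_map_le (S.hash v) i κ).not_gt ?_
    simpa only [Set.mem_ofPred_eq, code, hg] using hy
  refine div_le_of_le_mul₀ (Nat.cast_nonneg _) hδ ?_
  simpa [mul_comm] using Finset.sum_le_sum fun v (_ : v ∈ Finset.univ) => hv v

theorem eventProb_dec_lt_le (h : (W.word n).IsReliable S.f S.g δ)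
    (κ : Fin K ↪ Fin ((2 ^ S.m) ^ (S.k * (2 ^ S.m) ^ S.t)))
    (i : Fin ((2 ^ S.m) ^ (S.k * (2 ^ S.m) ^ S.t))) (v : Fin ((2 ^ S.m) ^ (S.k + 2))) :
    eventProb (W.word n (S.code.enc κ v)) {y | S.code.dec i y < firstRank i κ} ≤
      δ + if ∃ j, κ j ≠ i ∧ S.hash v (κ j) = S.hash v i then 1 else 0 := by
  split_ifs with hcoll
  · exact (eventProb_le_one _ _).trans (le_add_of_nonneg_left (h.nonneg))
  · rw [add_zero]
    refine (eventProb_mono _ fun y hy hg => ?_).trans (h (v, fun j => S.hash v (κ j)))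
    refine hcoll (exists_collision_of_firstRank_map_lt ?_)
    simpa only [Set.mem_ofPred_eq, code, hg] using hy

theorem typeII_le (h : (W.word n).IsReliable S.f S.g δ) :
    S.code.typeII W ≤ δ + K * S.hashError := by
  have hδ : 0 ≤ δ + K * S.hashError :=
    add_nonneg (h.nonneg) (mul_nonneg K.cast_nonneg S.hashError_nonneg)
  refine Real.iSup_le (fun κ => Real.iSup_le (fun i => ?_) hδ) hδ
  rw [RMOIDCode.decProb_eq]
  refine div_le_of_le_mul₀ (Nat.cast_nonneg _) hδ ?_
  have huniv : IsAlmostUniversal S.hash S.hashError := S.hash_universal.isAlmostUniversal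
  have hcoll := huniv.card_exists_collision_le S.hashError_nonneg κ i
  rw [Fintype.card_fin, Fintype.card_fin] at hcoll
  calc ∑ v, eventProb (W.word n (S.code.enc κ v)) {y | S.code.dec i y < firstRank i κ}
      ≤ ∑ v, (δ + if ∃ j, κ j ≠ i ∧ S.hash v (κ j) = S.hash v i then 1 else 0) :=
        Finset.sum_le_sum fun v _ => eventProb_dec_lt_le h κ i v
    _ = δ * ((2 ^ S.m) ^ (S.k + 2) : ℕ) +
          #{v | ∃ j, κ j ≠ i ∧ S.hash v (κ j) = S.hash v i} := by
        rw [Finset.sum_add_distrib, Finset.sum_boole, Finset.sum_const, Finset.card_univ,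
          Fintype.card_fin, nsmul_eq_mul, mul_comm]
    _ ≤ δ * ((2 ^ S.m) ^ (S.k + 2) : ℕ) + K * S.hashError * ((2 ^ S.m) ^ (S.k + 2) : ℕ) := by
        gcongr
    _ = (δ + K * S.hashError) * ((2 ^ S.m) ^ (S.k + 2) : ℕ) := (add_mul _ _ _).symm

end Errors

end RankedScheme

section Asymptotics

theorem logb_logb_pow_mul_pow {m k : ℕ} (hm : 1 ≤ m) (hk : 1 ≤ k) (t : ℕ) :
    Real.logb 2 (Real.logb 2 (((2 ^ m) ^ (k * (2 ^ m) ^ t) : ℕ) : ℝ)) =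
      Real.logb 2 (m * k) + m * t := by
  have hinner : Real.logb 2 (((2 ^ m) ^ (k * (2 ^ m) ^ t) : ℕ) : ℝ) = m * k * 2 ^ (m * t) := by
    push_cast
    rw [← pow_mul, ← pow_mul, Real.logb_pow, Real.logb_self_eq_one one_lt_two]
    push_cast
    ring
  rw [hinner, Real.logb_mul (by positivity) (by positivity), Real.logb_pow,
    Real.logb_self_eq_one one_lt_two, mul_one, Nat.cast_mul]

theorem tendsto_nat_sqrt_atTop : Tendsto Nat.sqrt atTop atTop :=
  tendsto_atTop.2 fun b => (eventually_ge_atTop (b * b)).mono fun _ => Nat.le_sqrt.2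

theorem tendsto_sqrt_div_self : Tendsto (fun n : ℕ => (n.sqrt : ℝ) / n) atTop (𝓝 0) := by
  have h : Tendsto (fun n : ℕ => 1 / (n.sqrt : ℝ)) atTop (𝓝 0) :=
    tendsto_one_div_atTop_nhds_zero_nat.comp tendsto_nat_sqrt_atTop
  refine squeeze_zero' (Eventually.of_forall fun n => by positivity) ?_ h
  filter_upwards [eventually_ge_atTop 1] with n hn
  rw [div_le_div_iff₀ (by positivity) (by exact_mod_cast Nat.sqrt_pos.2 hn), one_mul]
  exact_mod_cast Nat.sqrt_le n

theorem tendsto_logb_mul_div_self {γ : ℝ} (hγ : 0 < γ) :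
    Tendsto (fun n : ℕ => Real.logb 2 (n * γ) / n) atTop (𝓝 0) := by
  have hlog := (Real.isLittleO_log_id_atTop.tendsto_div_nhds_zero.comp
    (tendsto_natCast_atTop_atTop.atTop_mul_const hγ)).mul_const (γ / Real.log 2)
  rw [zero_mul] at hlog
  refine hlog.congr fun n => ?_
  simp only [Function.comp_apply, Real.logb, id_eq]
  field_simp

theorem tendsto_div_two_pow_sqrt : Tendsto (fun n : ℕ => (n : ℝ) / 2 ^ n.sqrt) atTop (𝓝 0) := by
  have hpoly : Tendsto (fun m : ℕ => 2 * (((m + 1 : ℕ) : ℝ) ^ 2 / 2 ^ (m + 1))) atTop (𝓝 0) := by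
    simpa using ((tendsto_add_atTop_iff_nat 1).2
      (tendsto_pow_const_div_const_pow_of_one_lt 2 (one_lt_two (α := ℝ)))).const_mul 2
  refine squeeze_zero (fun n => by positivity) (fun n => ?_)
    (hpoly.comp tendsto_nat_sqrt_atTop)
  have hn : (n : ℝ) ≤ ((n.sqrt + 1 : ℕ) : ℝ) ^ 2 := by
    exact_mod_cast (Nat.lt_succ_sqrt' n).le
  calc (n : ℝ) / 2 ^ n.sqrt ≤ ((n.sqrt + 1 : ℕ) : ℝ) ^ 2 / 2 ^ n.sqrt := by gcongr
    _ = 2 * (((n.sqrt + 1 : ℕ) : ℝ) ^ 2 / 2 ^ (n.sqrt + 1)) := by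
        rw [pow_succ 2]
        field_simp

theorem exists_nat_mul_add_le_lt {a b c : ℝ} (hb : 0 < b) (h : b * c ≤ a) :
    ∃ t : ℕ, b * (t + c) ≤ a ∧ a < b * (t + c + 1) := by
  have hc : c ≤ a / b := (le_div_iff₀' hb).2 h
  refine ⟨⌊a / b - c⌋₊, ?_, ?_⟩
  · rw [← le_div_iff₀' hb]
    linarith [Nat.floor_le (sub_nonneg.2 hc)]
  · rw [← div_lt_iff₀' hb]
    linarith [Nat.lt_floor_add_one (a / b - c)]

theorem eventually_sqrt_mul_le {γ : ℝ} (hγ : 0 < γ) (c : ℝ) :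
    ∀ᶠ n : ℕ in atTop, n.sqrt * c ≤ n * γ := by
  have hlarge : Tendsto (fun n : ℕ => (n.sqrt : ℝ) * γ) atTop atTop :=
    (tendsto_natCast_atTop_atTop.comp tendsto_nat_sqrt_atTop).atTop_mul_const hγ
  filter_upwards [hlarge.eventually_ge_atTop c] with n hn
  calc (n.sqrt : ℝ) * c ≤ n.sqrt * (n.sqrt * γ) := by gcongr
    _ = (n.sqrt * n.sqrt : ℕ) * γ := by
        push_cast
        ring
    _ ≤ n * γ := by
        gcongr
        exact Nat.sqrt_le n

theorem exists_tendsto_of_eventually_exists_dist_lt {S : ℕ → Type*} [∀ n, Nonempty (S n)]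
    {E : Type*} [PseudoMetricSpace E] (F : ∀ n, S n → E) (x : E)
    (h : ∀ ε > 0, ∀ᶠ n in atTop, ∃ s, dist (F n s) x < ε) :
    ∃ s : ∀ n, S n, Tendsto (fun n => F n (s n)) atTop (𝓝 x) := by
  have hnear (n : ℕ) : ∃ s, dist (F n s) x < (⨅ s, dist (F n s) x) + 1 / ((n : ℝ) + 1) :=
    exists_lt_of_ciInf_lt (lt_add_of_pos_right _ (by positivity))
  choose s hs using hnear
  refine ⟨s, Metric.tendsto_nhds.2 fun ε hε => ?_⟩
  filter_upwards [h (ε / 2) (half_pos hε),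
    (tendsto_one_div_add_atTop_nhds_zero_nat (𝕜 := ℝ)).eventually_lt_const (half_pos hε)]
    with n ⟨s', hs'⟩ hn
  have hinf : ⨅ s, dist (F n s) x ≤ dist (F n s') x :=
    ciInf_le ⟨0, Set.forall_mem_range.2 fun _ => dist_nonneg⟩ s'
  linarith [hs n]

end Asymptotics

namespace RankedScheme

variable {X Y : Type*} {K n : ℕ}

theorem nonempty [Nonempty X] : Nonempty (RankedScheme X Y K n) := by
  obtain ⟨h, hh⟩ := exists_kurosawaYoshida_hash (m := 1) (k := 1) le_rfl le_rfl 0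
  exact ⟨⟨1, le_rfl, 1, 0, rfl, h, hh, fun _ _ => Classical.arbitrary X,
    fun _ => Classical.arbitrary _⟩⟩

theorem abs_rate_sub_le (S : RankedScheme X Y K n) {γ : ℝ} (hn : 1 ≤ n)
    (hle : S.m * (S.t + (3 + K)) ≤ n * γ) (hlt : n * γ < S.m * (S.t + (3 + K) + 1)) :
    |S.code.rate - γ| ≤ (4 + K) * (S.m / n) + Real.logb 2 (n * γ) / n := by
  have hk : 1 ≤ S.k := S.ht ▸ S.t.succ_pos
  have hkt : (S.k : ℝ) = S.t + 1 := by exact_mod_cast S.ht.symm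
  have hm : (1 : ℝ) ≤ S.m := by exact_mod_cast S.hm
  have hmK : (0 : ℝ) ≤ S.m * K := by positivity
  have hmk_le : (S.m * S.k : ℝ) ≤ n * γ := by
    rw [hkt]
    linarith
  have hmk : (1 : ℝ) ≤ S.m * S.k := one_le_mul_of_one_le_of_one_le hm (by exact_mod_cast hk)
  have hlog_nonneg : 0 ≤ Real.logb 2 (S.m * S.k) := Real.logb_nonneg one_lt_two hmk
  have hlog_le : Real.logb 2 (S.m * S.k) ≤ Real.logb 2 (n * γ) :=
    Real.logb_le_logb_of_le one_lt_two (by linarith) hmk_le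
  have hrate : S.code.rate - γ = (Real.logb 2 (S.m * S.k) + S.m * S.t - n * γ) / n := by
    rw [RMOIDCode.rate, logb_logb_pow_mul_pow S.hm hk]
    field_simp
  calc |S.code.rate - γ| = |Real.logb 2 (S.m * S.k) + S.m * S.t - n * γ| / n := by
        rw [hrate, abs_div, Nat.abs_cast]
    _ ≤ ((4 + K) * S.m + Real.logb 2 (n * γ)) / n := by
        gcongr
        rw [abs_le]
        constructor <;> linarith
    _ = (4 + K) * (S.m / n) + Real.logb 2 (n * γ) / n := by ring

theorem hashError_le_mul_div (S : RankedScheme X Y K n) {γ : ℝ} (hn : 1 ≤ n)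
    (hle : S.m * (S.t + (3 + K)) ≤ n * γ) : S.hashError ≤ (γ + 1) * (n / 2 ^ S.m) := by
  have hm : (1 : ℝ) ≤ S.m := by exact_mod_cast S.hm
  have hn' : (1 : ℝ) ≤ n := by exact_mod_cast hn
  have ht : (S.t + 2 : ℝ) ≤ (γ + 1) * n := by
    calc (S.t + 2 : ℝ) ≤ S.t + (3 + K) + 1 := by linarith [K.cast_nonneg (α := ℝ)]
      _ ≤ S.m * (S.t + (3 + K)) + 1 := by
          gcongr
          exact le_mul_of_one_le_left (by positivity) hm
      _ ≤ n * γ + n := add_le_add hle hn'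
      _ = (γ + 1) * n := by ring
  rw [← mul_div_assoc]
  exact S.hashError_le.trans (by gcongr)

variable [Fintype X] [Fintype Y]

theorem eventually_exists_isReliable (W : DMC X Y) {γ δ : ℝ} (hγ : 0 < γ) (hγC : γ < W.capacity)
    (hδ : 0 < δ) (K : ℕ) :
    ∀ᶠ n : ℕ in atTop, ∃ S : RankedScheme X Y K n, S.m = n.sqrt ∧
      S.m * (S.t + (3 + K)) ≤ n * γ ∧ n * γ < S.m * (S.t + (3 + K) + 1) ∧
      (W.word n).IsReliable S.f S.g δ := by
  obtain ⟨P, hP⟩ := W.exists_lt_mutualInfo hγ.le hγC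
  filter_upwards [W.eventually_exists_isReliable P hP hδ, eventually_sqrt_mul_le hγ (3 + K),
    tendsto_nat_sqrt_atTop.eventually_ge_atTop 1] with n hcode hfit hm
  obtain ⟨t, hle, hlt⟩ := exists_nat_mul_add_le_lt (by positivity) hfit
  obtain ⟨h, hh⟩ := exists_kurosawaYoshida_hash hm t.succ_pos t
  have hcard : Fintype.card (Fin ((2 ^ n.sqrt) ^ (t + 1 + 2)) × (Fin K → Fin (2 ^ n.sqrt))) =
      2 ^ (n.sqrt * (t + (3 + K))) := by
    simp only [Fintype.card_prod, Fintype.card_fin, Fintype.card_fun]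
    rw [← pow_add, ← pow_mul]
    ring
  obtain ⟨f, g, hfg⟩ := hcode (Fin ((2 ^ n.sqrt) ^ (t + 1 + 2)) × (Fin K → Fin (2 ^ n.sqrt))) (by
    rw [hcard, Nat.cast_pow, Nat.cast_ofNat, ← Real.rpow_natCast]
    exact Real.rpow_le_rpow_of_exponent_le one_le_two (by exact_mod_cast hle))
  exact ⟨⟨n.sqrt, hm, t + 1, t, rfl, h, hh, f, g⟩, rfl, hle, hlt, hfg⟩

theorem eventually_exists_dist_performance_lt (W : DMC X Y) (hC : 0 < W.capacity) (K : ℕ) {ε : ℝ}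
    (hε : 0 < ε) :
    ∀ᶠ n : ℕ in atTop, ∃ S : RankedScheme X Y K n,
      dist (S.code.performance W) (W.capacity, 0, 0) < ε := by
  obtain ⟨γ, hγ, hγC⟩ := exists_between (max_lt (sub_lt_self W.capacity (half_pos hε)) hC)
  obtain ⟨hCγ, hγ0⟩ := max_lt_iff.1 hγ
  have hrate_lim := (tendsto_sqrt_div_self.const_mul (4 + K : ℝ)).add
    (tendsto_logb_mul_div_self hγ0)
  have hhash_lim := tendsto_div_two_pow_sqrt.const_mul (K * (γ + 1))
  rw [mul_zero, add_zero] at hrate_lim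
  rw [mul_zero] at hhash_lim
  filter_upwards [hrate_lim.eventually_lt_const (half_pos hε),
    hhash_lim.eventually_lt_const (half_pos hε), eventually_ge_atTop 1,
    eventually_exists_isReliable W hγ0 hγC (half_pos hε) K]
    with n hrate_small hhash_small hn ⟨S, hSm, hle, hlt, hS⟩
  have hrate : |S.code.rate - γ| < ε / 2 := by
    rw [← hSm] at hrate_small
    exact (S.abs_rate_sub_le hn hle hlt).trans_lt hrate_small
  have hhash : K * S.hashError < ε / 2 := by
    rw [← hSm, mul_assoc] at hhash_small
    exact (mul_le_mul_of_nonneg_left (S.hashError_le_mul_div hn hle) K.cast_nonneg).trans_lt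
      hhash_small
  have hI := typeI_le hS
  have hII := typeII_le hS
  refine ⟨S, ?_⟩
  change dist (S.code.rate, S.code.typeI W, S.code.typeII W) _ < ε
  rw [Prod.dist_eq, Prod.dist_eq, max_lt_iff, max_lt_iff, Real.dist_eq,
    Real.dist_0_eq_abs, Real.dist_0_eq_abs, abs_of_nonneg (S.code.typeI_nonneg W),
    abs_of_nonneg (S.code.typeII_nonneg W)]
  refine ⟨?_, by linarith, by linarith⟩
  rw [abs_lt] at hrate ⊢
  constructor <;> linarith

end RankedScheme

theorem corollary2 {X Y : Type*} [Fintype X] [Fintype Y] (W : DMC X Y) (hC : 0 < W.capacity)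
    (K : ℕ) (hK : 1 ≤ K) :
    ∃ S : (n : ℕ) → RankedScheme X Y K n,
      Filter.Tendsto (fun n => (S n).code.rate) Filter.atTop (nhds W.capacity) ∧
      Filter.Tendsto (fun n => (S n).code.typeI W) Filter.atTop (nhds 0) ∧
      Filter.Tendsto (fun n => (S n).code.typeII W) Filter.atTop (nhds 0) := by
  obtain ⟨P, -⟩ := W.exists_lt_mutualInfo le_rfl hC
  have : Nonempty X := nonempty_of_stdSimplex P
  have (n : ℕ) : Nonempty (RankedScheme X Y K n) := RankedScheme.nonempty
  obtain ⟨S, hS⟩ := exists_tendsto_of_eventually_exists_dist_lt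
    (fun n (S : RankedScheme X Y K n) => S.code.performance W) (W.capacity, 0, 0)
    fun _ => RankedScheme.eventually_exists_dist_performance_lt W hC K
  exact ⟨S, hS.fst_nhds, hS.snd_nhds.fst_nhds, hS.snd_nhds.snd_nhds⟩
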